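/- Let $d\ge 2$ and $n$ be integers. A classifier is a map $f:\mathbb{R}^d\to\{1,-1\}$. Let $\mathcal{F}$ be the class of homogeneous halfspaces in $\mathbb{R}^d$, i.e. of the classifiers $f_w$, $w\in\mathbb{R}^d\setminus\{0\}$, where $f_w(x)=1$ if $\langle w,x\rangle\ge 0$ and $f_w(x)=-1$ otherwise. For a distribution $P=P_{X,Y}$ on $\mathbb{R}^d\times\{1,-1\}$, let $R(f)=P(f(X)\ne Y)$ be the risk under the binary loss $\ell(y,y')=\mathbf{1}[y\neq y']$. If $f^*\in\mathcal{F}$ minimizes $R$ over $\mathcal{F}$, the excess loss class is $$\mathcal{L}_{\mathcal{Y}}=\{(x,y)\mapsto \ell(f(x),y)-\ell(f^*(x),y)\;:\;f\in\mathcal{F}\},$$ and it is called $(1,B)$-Bernstein if $\mathbb{E}\,g(X,Y)^2\le B\,\mathbb{E}\,g(X,Y)$ for all $g\in\mathcal{L}_{\mathcal{Y}}$. A learning algorithm maps a sample in $(\mathbb{R}^d\times\{1,-1\})^n$, and possibly an independent random seed (taking values in an arbitrary probability space), to a classifier $\tilde f$, not necessarily in $\mathcal{F}$, in a jointly measurable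 way. **Proposition (Lower bound for log-concave distributions).** There is a universal constant $c>0$ such that for all integers $d\ge 2$ and $n$, all real $B$ with $1\le B\le\sqrt{n/d}$, and every learning algorithm, there exists a distribution $P_{X,Y}$ on $\mathbb{R}^d\times\{1,-1\}$ such that - $P_X$ has a log-concave density with respect to Lebesgue measure, zero mean and identity covariance matrix (it is a zero-mean isotropic log-concave distribution); - a minimizer $f^*\in\mathcal{F}$ of the risk over $\mathcal{F}$ exists, and the excess loss class $\mathcal{L}_{\mathcal{Y}}$ is $(1,B)$-Bernstein; - the output $\tilde f$ of the algorithm on an i.i.d. sample of size $n$ from $P_{X,Y}$ satisfies $$\mathbb{E}\bigl(R(\tilde f)-R(f^*)\bigr)\ \ge\ c\,\frac{Bd}{n},$$ where the expectation is over the sample and the seed. -/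

import Mathlib

open MeasureTheory

noncomputable section

namespace Halfspaces

/-- The space of predictors `ℝ^d`, with its Euclidean structure. -/
abbrev Point (d : ℕ) : Type := EuclideanSpace ℝ (Fin d)

/-- The response variables: `ℤˣ` is the two-element set `{1, -1}`. -/
abbrev Label : Type := ℤˣ

/-- Every set of labels is measurable. -/
instance : DiscreteMeasurableSpace Label where
  forall_measurableSet s :=
    ⟨Units.val '' s, MeasurableSet.of_discrete, Set.preimage_image_eq s Units.val_injective⟩

/-- One labelled observation `(x, y)`. -/
abbrev Obs (d : ℕ) : Type := Point d × Label

/-- The classifier of the homogeneous halfspace with normal vector `w`. -/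
def halfspace {d : ℕ} (w : Point d) : Point d → Label :=
  open scoped Classical in fun x => if 0 ≤ inner ℝ w x then 1 else -1

/-- The class of all homogeneous halfspaces (boundary hyperplane through the origin). -/
def homogeneousHalfspaces (d : ℕ) : Set (Point d → Label) :=
  {f | ∃ w : Point d, w ≠ 0 ∧ f = halfspace w}

/-- The binary loss. -/
def binaryLoss (y y' : Label) : ℝ := if y ≠ y' then 1 else 0

/-- The risk of `f`, that is, its expected binary loss under `P`. -/
def risk {d : ℕ} (P : Measure (Obs d)) (f : Point d → Label) : ℝ :=
  ∫ z, binaryLoss (f z.1) z.2 ∂P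

/-- `f` minimizes the risk over the class `F`, and belongs to it. -/
def IsRiskMinimizer {d : ℕ} (P : Measure (Obs d)) (F : Set (Point d → Label))
    (f : Point d → Label) : Prop :=
  f ∈ F ∧ ∀ g ∈ F, risk P f ≤ risk P g

/-- The excess loss class of `F` relative to the reference classifier `fstar`. -/
def excessLossClass {d : ℕ} (F : Set (Point d → Label)) (fstar : Point d → Label) :
    Set (Obs d → ℝ) :=
  {g | ∃ f ∈ F, g = fun z => binaryLoss (f z.1) z.2 - binaryLoss (fstar z.1) z.2}

/-- The `(β, B)`-Bernstein condition `P g² ≤ B (P g)^β` for all `g` in the class. -/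
def IsBernstein {d : ℕ} (P : Measure (Obs d)) (G : Set (Obs d → ℝ)) (β B : ℝ) : Prop :=
  ∀ g ∈ G, ∫ z, (g z) ^ 2 ∂P ≤ B * (∫ z, g z ∂P) ^ β

/-- `μ` has a log-concave density with respect to Lebesgue measure. -/
def IsLogConcave {d : ℕ} (μ : Measure (Point d)) : Prop :=
  ∃ p : Point d → ℝ, Measurable p ∧ (∀ x, 0 ≤ p x) ∧
    (∀ x y : Point d, ∀ a b : ℝ, 0 ≤ a → 0 ≤ b → a + b = 1 →
      p x ^ a * p y ^ b ≤ p (a • x + b • y)) ∧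
    μ = volume.withDensity fun x => ENNReal.ofReal (p x)

/-- `μ` has finite second moments, mean zero and identity covariance matrix. -/
def IsZeroMeanIsotropic {d : ℕ} (μ : Measure (Point d)) : Prop :=
  MemLp (fun x : Point d => x) 2 μ ∧
    (∀ i : Fin d, ∫ x, x i ∂μ = 0) ∧
    ∀ i j : Fin d, ∫ x, x i * x j ∂μ = if i = j then 1 else 0

/-- A learning algorithm for samples of size `n`: it maps a sample, and an internal random seed
in `Ω`, to a classifier, which may be any function of `x` and need not be a halfspace.
A deterministic algorithm ignores the seed. -/
structure LearningAlgorithm (Ω : Type*) [MeasurableSpace Ω] (d n : ℕ) where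
  output : (Fin n → Obs d) → Ω → Point d → Label
  measurable_output :
    Measurable fun q : ((Fin n → Obs d) × Ω) × Point d => output q.1.1 q.1.2 q.2

/-- `E (R(f̃) - R(fstar))`, where `f̃` is the output of `A` on an i.i.d. sample from `P` and an
independent seed with law `Q`. -/
def expectedExcessRisk {Ω : Type*} [MeasurableSpace Ω] {d n : ℕ} (Q : Measure Ω)
    (A : LearningAlgorithm Ω d n) (P : Measure (Obs d)) (fstar : Point d → Label) : ℝ :=
  ∫ q : (Fin n → Obs d) × Ω, (risk P (A.output q.1 q.2) - risk P fstar)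
    ∂((Measure.pi fun _ : Fin n => P).prod Q)

end Halfspaces

end

/-!
The marginal `P_X` is the standard Gaussian on `ℝ^(k+1)`, `d = k + 1`, and the label of `x` equals
`f x` with probability `(1 + h) / 2`, where `h = 1 / B` and `f` is an unknown homogeneous
halfspace. For such a law the excess risk of any classifier `g` is `h * P_X(g ≠ f)`, so `f` is the
minimizer and the Bernstein condition holds with constant `1 / h = B`, with equality
(`risk_noisyLaw`, `isBernstein_noisyLaw`). It remains to show that no algorithm can locate `f`
up to `P_X`-distance `r` of order `ρ = κ k / (n h²)`, with `κ` a small constant.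

The candidates are the `2^k` halfspaces whose normals are `e₀ + δ ∑ σ_i e_{i+1}`, `σ ∈ {0, 1}^k`,
with `δ √k = ρ`. Two of them whose cube vertices are at Hamming distance more than `k / 8` are at
distance of order `ρ` (`hammingDist_le_of_close`). Hence any classifier is `r`-close only to
candidates in a Hamming ball of radius `k / 8`, which has at most `(3 / 2)^k` points.

The comparison with a common reference law is a version of Fano's inequality based on second
moments instead of entropies: for a density `L` and an event `A`,
`2 * 1_A * L ≤ t * L² + t⁻¹ * 1_A`, which bounds the average over the candidates of the
probability that the output is `r`-close to the true one (`exists_prod_apply_le`). A reference law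
that is too sharp gives infinite second moments in the noiseless case `B = 1`, and one that is too
flat loses the factor `ρ`. The choice here smooths the labels of the central halfspace
`{x₀ ≥ 0}`, at the scale `ρ`, with polynomial decay in `x₀ / ρ`. With it the second moment of the
likelihood ratio of one observation is `1 + O(h² ρ)` uniformly in `h ∈ (0, 1]`
(`lintegral_likelihoodRatio_sq_tiltedHalfspace_le`), so that for `n` observations it is at most
`(8 / 7)^k`, and `(3 / 2)^k * (8 / 7)^k` is a small fraction of `2^k`.
-/

noncomputable section

namespace Halfspaces

open ProbabilityTheory

/-! ### Densities on finite products and a second-moment Fano inequality -/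

theorem lintegral_pi_prod {n : ℕ} {X : Type*} [MeasurableSpace X] (ν : Measure X)
    [SigmaFinite ν] (f : Fin n → X → ENNReal) (hf : ∀ i, Measurable (f i)) :
    ∫⁻ x : Fin n → X, ∏ i, f i (x i) ∂(Measure.pi fun _ => ν) = ∏ i, ∫⁻ x, f i x ∂ν := by
  induction n with
  | zero => simp
  | succ n ih =>
    have hm : Measurable fun x : Fin n → X => ∏ i, f i.succ (x i) :=
      Finset.measurable_prod _ fun i _ => (hf i.succ).comp (measurable_pi_apply i)
    rw [← ((measurePreserving_piFinSuccAbove (fun _ : Fin (n + 1) => ν) 0).symm).lintegral_comp_emb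
      (MeasurableEquiv.measurableEmbedding _)]
    simp_rw [MeasurableEquiv.piFinSuccAbove_symm_apply, Fin.insertNthEquiv,
      Fin.prod_univ_succ, Fin.insertNth_zero, Equiv.coe_fn_mk, Fin.cons_succ, Fin.cons_zero]
    simp only [cast_eq]
    rw [lintegral_prod_mul (hf 0).aemeasurable hm.aemeasurable, ih _ fun i => hf i.succ]

theorem pi_withDensity {n : ℕ} {X : Type*} [MeasurableSpace X] (ν : Measure X) [SigmaFinite ν]
    (L : X → ENNReal) (hL : Measurable L) [SigmaFinite (ν.withDensity L)] :
    (Measure.pi fun _ : Fin n => ν.withDensity L)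
      = (Measure.pi fun _ : Fin n => ν).withDensity fun x => ∏ i, L (x i) := by
  refine Measure.pi_eq fun s hs => ?_
  rw [withDensity_apply _ (MeasurableSet.univ_pi hs), ← lintegral_indicator (MeasurableSet.univ_pi hs)]
  have : ∀ x : Fin n → X, (Set.univ.pi s).indicator (fun x => ∏ i, L (x i)) x
      = ∏ i, (s i).indicator L (x i) := by
    intro x
    by_cases hx : x ∈ Set.univ.pi s
    · rw [Set.indicator_of_mem hx]
      exact Finset.prod_congr rfl fun i _ => (Set.indicator_of_mem (hx i trivial) L).symm
    · rw [Set.indicator_of_notMem hx]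
      simp only [Set.mem_pi, Set.mem_univ, true_implies, not_forall] at hx
      obtain ⟨i, hi⟩ := hx
      exact (Finset.prod_eq_zero (Finset.mem_univ i) (Set.indicator_of_notMem hi L)).symm
  simp_rw [this]
  rw [lintegral_pi_prod ν (fun i => (s i).indicator L) fun i => hL.indicator (hs i)]
  exact Finset.prod_congr rfl fun i _ => by rw [withDensity_apply _ (hs i), lintegral_indicator (hs i)]

/-- The change of measure: integrate `2 * 1_A * L ≤ t * L ^ 2 + t⁻¹ * 1_A`. The free parameter `t`
replaces the square root of the Cauchy-Schwarz inequality. -/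
theorem two_mul_withDensity_apply_le {X : Type*} [MeasurableSpace X] (ν : Measure X)
    (L : X → ENNReal) (hL : Measurable L) {A : Set X} (hA : MeasurableSet A)
    {t : ENNReal} (ht0 : t ≠ 0) (ht : t ≠ ⊤) :
    2 * ν.withDensity L A ≤ t * ∫⁻ x, L x ^ 2 ∂ν + t⁻¹ * ν A := by
  rw [withDensity_apply _ hA, ← lintegral_indicator hA,
    ← lintegral_const_mul _ (hL.indicator hA),
    ← lintegral_const_mul _ (hL.pow_const 2), ← lintegral_indicator_one hA,
    ← lintegral_const_mul _ (measurable_one.indicator hA),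
    ← lintegral_add_left ((hL.pow_const 2).const_mul _)]
  refine lintegral_mono fun x => ?_
  by_cases hx : x ∈ A
  · simp only [Set.indicator_of_mem hx, Pi.one_apply, mul_one]
    by_cases hLx : L x = ⊤
    · simp [hLx, ENNReal.mul_top ht0]
    · lift L x to NNReal using hLx with l
      lift t to NNReal using ht
      have ht0' : t ≠ 0 := by simpa using ht0
      rw [← ENNReal.coe_inv ht0']
      norm_cast
      rw [← NNReal.coe_le_coe]
      push_cast
      have : (0 : ℝ) < t := by positivity
      have h2 : (t : ℝ) * l ^ 2 + (t : ℝ)⁻¹ - 2 * l = (t : ℝ)⁻¹ * (t * l - 1) ^ 2 := by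
        field_simp; ring
      have : 0 ≤ (t : ℝ)⁻¹ * (t * l - 1) ^ 2 := by positivity
      linarith
  · simp [Set.indicator_of_notMem hx]

/-- A form of Fano's inequality. Every law `ν.withDensity (L i)` has, for `n` observations, a
likelihood ratio with second moment at most `E` with respect to `ν`, and no outcome lies in more
than `N` of the events `A i`. If `N * E` is at most `6 / 7` of the number of candidates, then some
`A i` is not almost certain under its own law. The seed has law `S` and is independent of the
sample. -/
theorem exists_prod_apply_le {ι X Ω : Type*} [Fintype ι] [Nonempty ι] [MeasurableSpace X]
    [MeasurableSpace Ω] {n : ℕ} (ν : Measure X) [IsProbabilityMeasure ν]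
    (S : Measure Ω) [IsProbabilityMeasure S] (L : ι → X → ENNReal) (hL : ∀ i, Measurable (L i))
    (hP : ∀ i, IsProbabilityMeasure (ν.withDensity (L i)))
    (A : ι → Set ((Fin n → X) × Ω)) (hA : ∀ i, MeasurableSet (A i))
    (E N : NNReal) (hE : 0 < E) (hLE : ∀ i, (∫⁻ x, L i x ^ 2 ∂ν) ^ n ≤ E)
    (hN : ∀ z, ∑ i, (A i).indicator (1 : (Fin n → X) × Ω → ENNReal) z ≤ N)
    (hNE : 7 * (N * E) ≤ 6 * Fintype.card ι) :
    ∃ i, ((Measure.pi fun _ : Fin n => ν.withDensity (L i)).prod S).real (A i) ≤ 13 / 14 := by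
  have key : ∀ i, 2 * ((Measure.pi fun _ : Fin n => ν.withDensity (L i)).prod S) (A i)
      ≤ 1 + E * ((Measure.pi fun _ : Fin n => ν).prod S) (A i) := by
    intro i
    have := hP i
    have hE' : (E : ENNReal) ≠ 0 := by simpa using hE.ne'
    have hpm : Measurable fun x : Fin n → X => ∏ j, L i (x j) :=
      Finset.measurable_prod _ fun j _ => (hL i).comp (measurable_pi_apply j)
    rw [Measure.prod_apply_symm (hA i), Measure.prod_apply_symm (hA i),
      ← lintegral_const_mul _ (measurable_measure_prodMk_right (hA i)),
      ← lintegral_const_mul _ (measurable_measure_prodMk_right (hA i))]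
    have h1 : (1 : ENNReal) = ∫⁻ _, 1 ∂S := by simp
    rw [h1, ← lintegral_add_left measurable_const]
    refine lintegral_mono fun ω => ?_
    rw [pi_withDensity ν (L i) (hL i)]
    refine (two_mul_withDensity_apply_le _ _ hpm
      (measurable_prodMk_right (hA i)) (t := (E : ENNReal)⁻¹) (by simp) (by simpa using hE.ne')).trans ?_
    rw [inv_inv]
    gcongr
    simp_rw [← Finset.prod_pow]
    rw [lintegral_pi_prod ν (fun _ x => L i x ^ 2) fun _ => (hL i).pow_const 2, Finset.prod_const,
      Finset.card_univ, Fintype.card_fin]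
    calc (E : ENNReal)⁻¹ * (∫⁻ x, L i x ^ 2 ∂ν) ^ n ≤ (E : ENNReal)⁻¹ * E := by gcongr; exact hLE i
      _ = 1 := ENNReal.inv_mul_cancel hE' (by simp)
  have hsum : ∑ i, ((Measure.pi fun _ : Fin n => ν).prod S) (A i) ≤ N := by
    calc ∑ i, ((Measure.pi fun _ : Fin n => ν).prod S) (A i)
        = ∫⁻ z, ∑ i, (A i).indicator (1 : (Fin n → X) × Ω → ENNReal) z
            ∂((Measure.pi fun _ : Fin n => ν).prod S) := by
          rw [lintegral_finsetSum _ fun i _ => measurable_one.indicator (hA i)]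
          exact Finset.sum_congr rfl fun i _ => (lintegral_indicator_one (hA i)).symm
      _ ≤ ∫⁻ _, N ∂((Measure.pi fun _ : Fin n => ν).prod S) := lintegral_mono hN
      _ = N := by simp
  by_contra! hcon
  have hreal : ∀ i, (2 : ℝ) * (13 / 14)
      < 1 + E * ((Measure.pi fun _ : Fin n => ν).prod S).real (A i) := by
    intro i
    have := hP i
    have h := ENNReal.toReal_mono (by finiteness) (key i)
    rw [ENNReal.toReal_add (by simp) (by finiteness), ENNReal.toReal_mul, ENNReal.toReal_mul] at h
    simp only [ENNReal.toReal_ofNat, ENNReal.toReal_one, ENNReal.coe_toReal] at h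
    have := hcon i
    simp only [Measure.real] at this ⊢
    linarith
  have hs : ∑ i, ((Measure.pi fun _ : Fin n => ν).prod S).real (A i) ≤ N := by
    have h := ENNReal.toReal_mono (by simp) hsum
    rwa [ENNReal.toReal_sum (fun i _ => by finiteness)] at h
  have hlt := Finset.sum_lt_sum_of_nonempty Finset.univ_nonempty fun i _ => hreal i
  rw [Finset.sum_add_distrib, ← Finset.mul_sum Finset.univ _ (E : ℝ)] at hlt
  simp only [Finset.sum_const, Finset.card_univ, nsmul_eq_mul] at hlt
  have h7 : (7 : ℝ) * (N * E) ≤ 6 * Fintype.card ι := by exact_mod_cast hNE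
  have := mul_le_mul_of_nonneg_left hs E.2
  simp only [NNReal.val_eq_coe] at this
  nlinarith

/-! ### Laws of labelled observations -/

/-- The law of `(x, y)` where `x` has law `μ` and, given `x`, the label `y` has mean `b x`, that is,
`y = 1` with probability `(1 + b x) / 2`. It is given by its density with respect to the product of
`μ` and the counting measure on labels; the values of `b` are meant to lie in `[-1, 1]`. -/
def labelLaw {d : ℕ} (μ : Measure (Point d)) (b : Point d → ℝ) : Measure (Obs d) :=
  (μ.prod Measure.count).withDensity fun z => ENNReal.ofReal ((1 + b z.1 * ((z.2 : ℤ) : ℝ)) / 2)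

section labelLaw

variable {d : ℕ} {μ : Measure (Point d)} {b : Point d → ℝ}

theorem measurable_labelDensity (hb : Measurable b) :
    Measurable fun z : Obs d => (1 + b z.1 * ((z.2 : ℤ) : ℝ)) / 2 := by
  have h : Measurable fun y : Label => ((y : ℤ) : ℝ) := Measurable.of_discrete
  exact ((((hb.comp measurable_fst).mul (h.comp measurable_snd)).const_add 1).div_const 2)

theorem lintegral_labelLaw (hb : Measurable b) {F : Obs d → ENNReal} (hF : Measurable F) :
    ∫⁻ z, F z ∂(labelLaw μ b) = ∫⁻ x, (ENNReal.ofReal ((1 + b x) / 2) * F (x, 1)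
      + ENNReal.ofReal ((1 - b x) / 2) * F (x, -1)) ∂μ := by
  have hD := (measurable_labelDensity hb).ennreal_ofReal
  rw [labelLaw, lintegral_withDensity_eq_lintegral_mul _ hD hF,
    lintegral_prod _ (hD.mul hF).aemeasurable]
  refine lintegral_congr fun x => ?_
  rw [lintegral_count, tsum_fintype, UnitsInt.univ, Finset.sum_pair (by decide)]
  simp [sub_eq_add_neg]

theorem map_fst_labelLaw (hb : Measurable b) (hb1 : ∀ x, |b x| ≤ 1) : (labelLaw μ b).fst = μ := by
  ext s hs
  rw [Measure.fst_apply hs, ← lintegral_indicator_one (measurable_fst hs),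
    lintegral_labelLaw hb (measurable_one.indicator (measurable_fst hs)), ← lintegral_indicator_one hs]
  refine lintegral_congr fun x => ?_
  have h := abs_le.1 (hb1 x)
  by_cases hx : x ∈ s
  · simp only [Set.indicator, Set.mem_preimage, hx, if_true, Pi.one_apply, mul_one]
    rw [← ENNReal.ofReal_add (by linarith) (by linarith)]
    ring_nf; simp
  · simp [Set.indicator, hx]

variable [IsProbabilityMeasure μ]

theorem isProbabilityMeasure_labelLaw (hb : Measurable b) (hb1 : ∀ x, |b x| ≤ 1) :
    IsProbabilityMeasure (labelLaw μ b) := by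
  constructor
  rw [← Measure.fst_univ, map_fst_labelLaw hb hb1, measure_univ]

theorem integral_labelLaw (hb : Measurable b) (hb1 : ∀ x, |b x| ≤ 1) {F : Obs d → ℝ}
    (hF : Measurable F) (hF0 : ∀ z, |F z| ≤ 1) :
    ∫ z, F z ∂(labelLaw μ b)
      = ∫ x, ((1 + b x) / 2 * F (x, 1) + (1 - b x) / 2 * F (x, -1)) ∂μ := by
  have hD := measurable_labelDensity hb
  have hD1 : ∀ z : Obs d, |(1 + b z.1 * ((z.2 : ℤ) : ℝ)) / 2| ≤ 1 := by
    rintro ⟨x, y⟩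
    have h := abs_le.1 (hb1 x)
    rcases Int.units_eq_one_or y with rfl | rfl <;> simp [abs_le] <;> constructor <;> linarith
  have hD0 : ∀ z : Obs d, 0 ≤ (1 + b z.1 * ((z.2 : ℤ) : ℝ)) / 2 := by
    rintro ⟨x, y⟩
    have h := abs_le.1 (hb1 x)
    rcases Int.units_eq_one_or y with rfl | rfl <;> simp <;> linarith
  rw [labelLaw, integral_withDensity_eq_integral_toReal_smul hD.ennreal_ofReal (by simp)]
  simp_rw [ENNReal.toReal_ofReal (hD0 _), smul_eq_mul]
  rw [integral_prod]
  · refine integral_congr_ae (.of_forall fun x => ?_)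
    simp only
    rw [integral_fintype (.of_finite), UnitsInt.univ, Finset.sum_pair (by decide)]
    simp [sub_eq_add_neg]
  · refine Integrable.of_bound (hD.mul hF).aestronglyMeasurable 1 (.of_forall fun z => ?_)
    rw [Real.norm_eq_abs, abs_mul]
    exact mul_le_one₀ (hD1 z) (abs_nonneg _) (hF0 z)

end labelLaw

section noisy

variable {d : ℕ} {μ : Measure (Point d)} [IsProbabilityMeasure μ] {h : ℝ} {f g : Point d → Label}

/-- The law of `(x, y)` where `x` has law `μ` and `y` is `f x` with probability `(1 + h) / 2` and
`-f x` otherwise. -/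
def noisyLaw (μ : Measure (Point d)) (h : ℝ) (f : Point d → Label) : Measure (Obs d) :=
  labelLaw μ fun x => h * ((f x : ℤ) : ℝ)

theorem measurable_sgn (hf : Measurable f) : Measurable fun x => ((f x : ℤ) : ℝ) :=
  (Measurable.of_discrete (f := fun y : Label => ((y : ℤ) : ℝ))).comp hf

theorem abs_mul_sgn_le (h0 : 0 ≤ h) (h1 : h ≤ 1) (x : Point d) : |h * ((f x : ℤ) : ℝ)| ≤ 1 := by
  rcases Int.units_eq_one_or (f x) with e | e <;> simp [e, abs_of_nonneg h0, h1]

theorem measurable_binaryLoss (hf : Measurable f) :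
    Measurable fun z : Obs d => binaryLoss (f z.1) z.2 :=
  (Measurable.of_discrete (f := fun p : Label × Label => binaryLoss p.1 p.2)).comp
    ((hf.comp measurable_fst).prodMk measurable_snd)

theorem measurableSet_ne (hf : Measurable f) (hg : Measurable g) :
    MeasurableSet {x | g x ≠ f x} := by
  exact (measurableSet_eq_fun hg hf).compl

/-- Reduction of an expectation under `noisyLaw` to the disagreement probability of `f` and `g`:
it suffices to know the conditional expectation `a + c * 1[g x ≠ f x]` of `F` given `x`. -/
theorem integral_noisyLaw_eq (h0 : 0 ≤ h) (h1 : h ≤ 1) (hf : Measurable f) (hg : Measurable g)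
    {F : Obs d → ℝ} (hF : Measurable F) (hF0 : ∀ z, |F z| ≤ 1) {a c : ℝ}
    (hFe : ∀ x, (1 + h * ((f x : ℤ) : ℝ)) / 2 * F (x, 1) + (1 - h * ((f x : ℤ) : ℝ)) / 2 * F (x, -1)
      = a + c * {x | g x ≠ f x}.indicator 1 x) :
    ∫ z, F z ∂(noisyLaw μ h f) = a + c * μ.real {x | g x ≠ f x} := by
  rw [noisyLaw, integral_labelLaw ((measurable_sgn hf).const_mul h) (abs_mul_sgn_le h0 h1) hF hF0]
  simp_rw [hFe]
  have hm := measurableSet_ne hf hg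
  rw [integral_add (integrable_const _) (((integrable_const _).indicator hm).const_mul _),
    integral_const_mul, integral_indicator_one hm]
  simp

theorem risk_noisyLaw (h0 : 0 ≤ h) (h1 : h ≤ 1) (hf : Measurable f) (hg : Measurable g) :
    risk (noisyLaw μ h f) g = (1 - h) / 2 + h * μ.real {x | g x ≠ f x} := by
  refine integral_noisyLaw_eq h0 h1 hf hg (measurable_binaryLoss hg)
    (fun z => by unfold binaryLoss; split_ifs <;> simp) fun x => ?_
  rcases Int.units_eq_one_or (f x) with e | e <;> rcases Int.units_eq_one_or (g x) with e' | e' <;>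
    simp [e, e', binaryLoss, Set.indicator, Int.units_ne_iff_eq_neg] <;> ring

/-- Both sides of the Bernstein condition are equal to `μ {x | g x ≠ f x}`. -/
theorem isBernstein_noisyLaw (h0 : 0 < h) (h1 : h ≤ 1) (hf : Measurable f)
    {G : Set (Point d → Label)} (hG : ∀ g ∈ G, Measurable g) :
    IsBernstein (noisyLaw μ h f) (excessLossClass G f) 1 (1 / h) := by
  rintro _ ⟨g, hgG, rfl⟩
  have hg := hG g hgG
  have hm : Measurable fun z : Obs d => binaryLoss (g z.1) z.2 - binaryLoss (f z.1) z.2 :=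
    (measurable_binaryLoss hg).sub (measurable_binaryLoss hf)
  beta_reduce
  rw [integral_noisyLaw_eq (a := 0) (c := h) h0.le h1 hf hg hm, Real.rpow_one,
    integral_noisyLaw_eq (a := 0) (c := 1) h0.le h1 hf hg (hm.pow_const 2)]
  · apply le_of_eq; field_simp; ring
  · intro z; simp only [binaryLoss]; split_ifs <;> simp
  · intro x
    rcases Int.units_eq_one_or (f x) with e | e <;> rcases Int.units_eq_one_or (g x) with e' | e' <;>
      simp [e, e', binaryLoss, Set.indicator] <;> ring
  · intro z; simp only [binaryLoss]; split_ifs <;> simp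
  · intro x
    rcases Int.units_eq_one_or (f x) with e | e <;> rcases Int.units_eq_one_or (g x) with e' | e' <;>
      simp [e, e', binaryLoss, Set.indicator] <;> ring

theorem isRiskMinimizer_noisyLaw (h0 : 0 ≤ h) (h1 : h ≤ 1)
    {G : Set (Point d → Label)} (hG : ∀ g ∈ G, Measurable g) (hf : f ∈ G) :
    IsRiskMinimizer (noisyLaw μ h f) G f := by
  refine ⟨hf, fun g hg => ?_⟩
  rw [risk_noisyLaw h0 h1 (hG f hf) (hG f hf), risk_noisyLaw h0 h1 (hG f hf) (hG g hg)]
  simp only [ne_eq, not_true_eq_false, Set.ofPred_false, measureReal_empty]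
  gcongr
  exact measureReal_nonneg

end noisy

/-! ### Likelihood ratios and the excess risk -/

section likelihood
variable {d : ℕ} {μ : Measure (Point d)} {a b : Point d → ℝ}

/-- The density of `labelLaw μ a` with respect to `labelLaw μ b`, provided that `|b| < 1`. -/
def likelihoodRatio (a b : Point d → ℝ) (z : Obs d) : ENNReal :=
  ENNReal.ofReal ((1 + a z.1 * ((z.2 : ℤ) : ℝ)) / (1 + b z.1 * ((z.2 : ℤ) : ℝ)))

theorem measurable_likelihoodRatio (ha : Measurable a) (hb : Measurable b) :
    Measurable (likelihoodRatio a b) := by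
  have h : Measurable fun y : Label => ((y : ℤ) : ℝ) := Measurable.of_discrete
  exact ((((ha.comp measurable_fst).mul (h.comp measurable_snd)).const_add 1).div
    (((hb.comp measurable_fst).mul (h.comp measurable_snd)).const_add 1)).ennreal_ofReal

theorem labelLaw_eq_withDensity (ha : Measurable a) (hb : Measurable b) (hb1 : ∀ x, |b x| < 1) :
    labelLaw μ a = (labelLaw μ b).withDensity (likelihoodRatio a b) := by
  rw [labelLaw, labelLaw, ← withDensity_mul _ (measurable_labelDensity hb).ennreal_ofReal
    (measurable_likelihoodRatio ha hb)]
  congr 1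
  ext ⟨x, y⟩
  have hpos : 0 < 1 + b x * ((y : ℤ) : ℝ) := by
    have h := abs_lt.1 (hb1 x)
    rcases Int.units_eq_one_or y with rfl | rfl <;> simp <;> linarith
  simp only [Pi.mul_apply, likelihoodRatio]
  rw [← ENNReal.ofReal_mul (by positivity)]
  congr 1
  generalize 1 + b x * ((y : ℤ) : ℝ) = u at hpos
  field_simp

theorem lintegral_likelihoodRatio_sq (ha : Measurable a) (hb : Measurable b)
    (ha1 : ∀ x, |a x| ≤ 1) (hb1 : ∀ x, |b x| < 1) :
    ∫⁻ z, likelihoodRatio a b z ^ 2 ∂(labelLaw μ b)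
      = ∫⁻ x, ENNReal.ofReal (1 + (a x - b x) ^ 2 / (1 - b x ^ 2)) ∂μ := by
  rw [lintegral_labelLaw hb ((measurable_likelihoodRatio ha hb).pow_const 2)]
  refine lintegral_congr fun x => ?_
  have h := abs_lt.1 (hb1 x)
  have h' := abs_le.1 (ha1 x)
  have p1 : 0 < 1 + b x := by linarith
  have p2 : 0 < 1 - b x := by linarith
  have q1 : 0 ≤ 1 + a x := by linarith
  have q2 : 0 ≤ 1 - a x := by linarith
  have e : 1 - b x ^ 2 = (1 + b x) * (1 - b x) := by ring
  simp only [likelihoodRatio, Units.val_one, Int.cast_one, mul_one, Units.val_neg, Int.cast_neg,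
    mul_neg, ← sub_eq_add_neg]
  rw [← ENNReal.ofReal_pow (by positivity), ← ENNReal.ofReal_pow (by positivity),
    ← ENNReal.ofReal_mul (by positivity), ← ENNReal.ofReal_mul (by positivity),
    ← ENNReal.ofReal_add (by positivity) (by positivity), e]
  congr 1
  field_simp
  ring

/-- The chi-square divergence of a label with mean `h * s` from one with mean
`h * (1 - φ) / (1 + φ) * s₀`, for signs `s` and `s₀`: it is at most `h ^ 2 * φ` if the signs agree
and at most `h ^ 2 * φ⁻¹` more if they do not. -/
theorem chiSq_le {h φ s s₀ : ℝ} (h0 : 0 ≤ h) (h1 : h ≤ 1) (hφ : 0 < φ)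
    (hs : s = 1 ∨ s = -1) (hs₀ : s₀ = 1 ∨ s₀ = -1) :
    (h * s - h * ((1 - φ) / (1 + φ)) * s₀) ^ 2 / (1 - (h * ((1 - φ) / (1 + φ)) * s₀) ^ 2)
      ≤ h ^ 2 * (φ + if s = s₀ then 0 else φ⁻¹) := by
  set m := (1 - φ) / (1 + φ) with hm
  have hs2 : s₀ ^ 2 = 1 := by rcases hs₀ with rfl | rfl <;> norm_num
  -- The noiseless variance `1 - m ^ 2` bounds the denominator from below for every `h`.
  have hm2 : 1 - m ^ 2 = 4 * φ / (1 + φ) ^ 2 := by rw [hm]; field_simp; ring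
  have hmpos : 0 < 1 - m ^ 2 := by rw [hm2]; positivity
  have hh : h ^ 2 ≤ 1 := pow_le_one₀ h0 h1
  have hden : 1 - m ^ 2 ≤ 1 - (h * m * s₀) ^ 2 := by
    rw [mul_pow, mul_pow, hs2]; nlinarith [sq_nonneg m]
  have hnum : (h * s - h * m * s₀) ^ 2 = h ^ 2 * (φ + if s = s₀ then 0 else φ⁻¹) * (1 - m ^ 2)
      - if s = s₀ then 0 else h ^ 2 * φ * (1 - m ^ 2) := by
    rw [hm2, hm]
    split_ifs with hss
    · rw [hss, show (h * s₀ - h * ((1 - φ) / (1 + φ)) * s₀) ^ 2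
        = h ^ 2 * s₀ ^ 2 * (1 - (1 - φ) / (1 + φ)) ^ 2 by ring, hs2]
      field_simp; ring
    · have : s = -s₀ := by
        rcases hs with rfl | rfl <;> rcases hs₀ with rfl | rfl <;> simp at hss ⊢
      rw [this, show (h * -s₀ - h * ((1 - φ) / (1 + φ)) * s₀) ^ 2
        = h ^ 2 * s₀ ^ 2 * (1 + (1 - φ) / (1 + φ)) ^ 2 by ring, hs2]
      field_simp; ring
  have hnn : 0 ≤ h ^ 2 * (φ + if s = s₀ then 0 else φ⁻¹) := by
    split_ifs <;> positivity
  have hnn' : 0 ≤ if s = s₀ then 0 else h ^ 2 * φ * (1 - m ^ 2) := by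
    split_ifs <;> positivity
  rw [div_le_iff₀ (hmpos.trans_le hden), hnum]
  nlinarith [mul_le_mul_of_nonneg_left hden hnn]

end likelihood

section excess

variable {d n : ℕ} {μ : Measure (Point d)} [IsProbabilityMeasure μ]
  {Ω : Type*} [MeasurableSpace Ω]

theorem measurable_output_apply (A : LearningAlgorithm Ω d n) (s : Fin n → Obs d) (ω : Ω) :
    Measurable (A.output s ω) :=
  A.measurable_output.comp (measurable_prodMk_left (x := (s, ω)))

theorem measurable_measureReal_output_ne (A : LearningAlgorithm Ω d n) {f : Point d → Label}
    (hf : Measurable f) :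
    Measurable fun q : (Fin n → Obs d) × Ω => μ.real {x | A.output q.1 q.2 x ≠ f x} := by
  have hs : MeasurableSet {p : ((Fin n → Obs d) × Ω) × Point d | A.output p.1.1 p.1.2 p.2 ≠ f p.2} :=
    (measurableSet_eq_fun A.measurable_output (hf.comp measurable_snd)).compl
  exact (measurable_measure_prodMk_left hs).ennreal_toReal

/-- Markov's inequality for the output: if the output is `r`-close to `f` with probability at most
`p`, then the expected excess risk is at least `h * r * (1 - p)`. -/
theorem le_expectedExcessRisk (Q : Measure Ω) [IsProbabilityMeasure Q]
    (A : LearningAlgorithm Ω d n) {f : Point d → Label} (hf : Measurable f) {h r p : ℝ}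
    (h0 : 0 ≤ h) (h1 : h ≤ 1) (hr : 0 ≤ r)
    (hp : ((Measure.pi fun _ : Fin n => noisyLaw μ h f).prod Q).real
      {q | μ.real {x | A.output q.1 q.2 x ≠ f x} < r} ≤ p) :
    h * (r * (1 - p)) ≤ expectedExcessRisk Q A (noisyLaw μ h f) f := by
  have : IsProbabilityMeasure (noisyLaw μ h f) :=
    isProbabilityMeasure_labelLaw ((measurable_sgn hf).const_mul h) (abs_mul_sgn_le h0 h1)
  have hm := measurable_measureReal_output_ne (μ := μ) A hf
  set D := fun q : (Fin n → Obs d) × Ω => μ.real {x | A.output q.1 q.2 x ≠ f x} with hD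
  have hS : MeasurableSet {q | D q < r} := measurableSet_lt hm measurable_const
  have hDi : Integrable D ((Measure.pi fun _ : Fin n => noisyLaw μ h f).prod Q) :=
    Integrable.of_bound hm.aestronglyMeasurable 1 (.of_forall fun q => by
      rw [Real.norm_eq_abs, abs_of_nonneg measureReal_nonneg]; exact measureReal_le_one)
  have he : expectedExcessRisk Q A (noisyLaw μ h f) f
      = h * ∫ q, D q ∂((Measure.pi fun _ : Fin n => noisyLaw μ h f).prod Q) := by
    rw [expectedExcessRisk, ← integral_const_mul]
    refine integral_congr_ae (.of_forall fun q => ?_)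
    simp only [risk_noisyLaw h0 h1 hf hf, risk_noisyLaw h0 h1 hf (measurable_output_apply A q.1 q.2), hD]
    simp
  rw [he]
  refine mul_le_mul_of_nonneg_left ?_ h0
  calc r * (1 - p) ≤ r * ((Measure.pi fun _ : Fin n => noisyLaw μ h f).prod Q).real {q | D q < r}ᶜ := by
        rw [probReal_compl_eq_one_sub hS]; gcongr
    _ = ∫ q, r * {q | D q < r}ᶜ.indicator 1 q
          ∂((Measure.pi fun _ : Fin n => noisyLaw μ h f).prod Q) := by
        rw [integral_const_mul, integral_indicator_one hS.compl]
    _ ≤ _ := by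
        refine integral_mono (((integrable_const _).indicator hS.compl).const_mul _) hDi fun q => ?_
        by_cases hq : D q < r
        · have h0 : 0 ≤ D q := measureReal_nonneg
          simpa [Set.indicator, hq] using h0
        · have h0 : r ≤ D q := not_lt.1 hq
          simpa [Set.indicator, hq] using h0

end excess

/-! ### The standard Gaussian measure -/

theorem gaussianPDFReal_log_concave (s t a b : ℝ) (ha : 0 ≤ a) (hb : 0 ≤ b) (hab : a + b = 1) :
    gaussianPDFReal 0 1 s ^ a * gaussianPDFReal 0 1 t ^ b ≤ gaussianPDFReal 0 1 (a * s + b * t) := by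
  have hc : 0 < (√(2 * Real.pi))⁻¹ := by positivity
  simp only [gaussianPDFReal, NNReal.coe_one, mul_one, sub_zero]
  rw [Real.mul_rpow hc.le (Real.exp_nonneg _), Real.mul_rpow hc.le (Real.exp_nonneg _),
    ← Real.exp_mul, ← Real.exp_mul, mul_mul_mul_comm, ← Real.rpow_add hc, hab, Real.rpow_one,
    ← Real.exp_add]
  gcongr
  -- Convexity of the square: `a * s² + b * t² - (a * s + b * t)² = a * b * (s - t)²`.
  obtain rfl : b = 1 - a := by linarith
  nlinarith [mul_nonneg (mul_nonneg ha hb) (sq_nonneg (s - t))]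

theorem isLogConcave_stdGaussian (d : ℕ) : IsLogConcave (stdGaussian (Point d)) := by
  have hm : Measurable fun x : Point d => ∏ i, gaussianPDFReal 0 1 (x i) :=
    Finset.measurable_prod _ fun i _ => (measurable_gaussianPDFReal 0 1).comp (by fun_prop)
  refine ⟨fun x => ∏ i, gaussianPDFReal 0 1 (x i), hm, fun x =>
    Finset.prod_nonneg fun i _ => gaussianPDFReal_nonneg _ _ _, fun x y a b ha hb hab => ?_, ?_⟩
  · rw [← Real.finsetProd_rpow _ _ fun i _ => gaussianPDFReal_nonneg _ _ _,
      ← Real.finsetProd_rpow _ _ fun i _ => gaussianPDFReal_nonneg _ _ _,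
      ← Finset.prod_mul_distrib]
    refine Finset.prod_le_prod (fun i _ => ?_) fun i _ => ?_
    · exact mul_nonneg (Real.rpow_nonneg (gaussianPDFReal_nonneg _ _ _) _)
        (Real.rpow_nonneg (gaussianPDFReal_nonneg _ _ _) _)
    · simpa using gaussianPDFReal_log_concave (x i) (y i) a b ha hb hab
  · have hg : gaussianReal 0 1 = volume.withDensity (gaussianPDF 0 1) :=
      gaussianReal_of_var_ne_zero 0 one_ne_zero
    have : SigmaFinite (volume.withDensity (gaussianPDF 0 1)) := by rw [← hg]; infer_instance
    rw [← map_pi_eq_stdGaussian, hg, pi_withDensity _ _ (measurable_gaussianPDF 0 1)]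
    ext s hs
    have hp := PiLp.volume_preserving_toLp (Fin d)
    rw [Measure.map_apply (by fun_prop) hs, withDensity_apply _ (hs.preimage (by fun_prop)),
      withDensity_apply _ hs, ← hp.setLIntegral_comp_preimage hs hm.ennreal_ofReal]
    refine lintegral_congr fun x => ?_
    simp only [gaussianPDF]
    rw [ENNReal.ofReal_prod_of_nonneg fun i _ => gaussianPDFReal_nonneg _ _ _]

theorem isZeroMeanIsotropic_stdGaussian (d : ℕ) : IsZeroMeanIsotropic (stdGaussian (Point d)) := by
  have hL : MemLp (fun x : Point d => x) 2 (stdGaussian (Point d)) := IsGaussian.memLp_two_id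
  have hi : ∀ i, ∫ x : Point d, x i ∂(stdGaussian (Point d)) = 0 := fun i =>
    integral_strongDual_stdGaussian (E := Point d) (EuclideanSpace.proj i)
  refine ⟨hL, hi, fun i j => ?_⟩
  have hLi : ∀ i, MemLp (fun x : Point d => x i) 2 (stdGaussian (Point d)) := fun i =>
    (EuclideanSpace.proj (𝕜 := ℝ) i).comp_memLp' hL
  have h := covariance_eval_multivariateGaussian (μ := (0 : Point d)) Matrix.PosSemidef.one i j
  rw [multivariateGaussian_zero_one, covariance_eq_sub (hLi i) (hLi j), hi, hi, Matrix.one_apply] at h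
  simpa using h

section pi
variable {k : ℕ}

theorem map_sum_mul_pi_gaussianReal (a : Fin k → ℝ) :
    (Measure.pi fun _ : Fin k => gaussianReal 0 1).map (fun y => ∑ i, a i * y i)
      = (gaussianReal 0 1).map fun t => √(∑ i, a i ^ 2) * t := by
  have h := IsGaussian.map_eq_gaussianReal (μ := stdGaussian (Point k))
    (innerSL ℝ (WithLp.toLp 2 a : Point k))
  rw [integral_strongDual_stdGaussian, variance_dual_stdGaussian, innerSL_apply_norm,
    EuclideanSpace.real_norm_sq_eq, ← map_pi_eq_stdGaussian,
    Measure.map_map (by fun_prop) (by fun_prop)] at h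
  rw [gaussianReal_map_const_mul]
  convert h using 2
  · ext y
    simp [PiLp.inner_apply, mul_comm]
  · simp
  · ext
    simp [Real.sq_sqrt (Finset.sum_nonneg fun i _ => sq_nonneg (a i)),
      Real.coe_toNNReal _ (Finset.sum_nonneg fun i _ => sq_nonneg (a i))]

theorem lintegral_comp_sum_mul (a : Fin k → ℝ) {F : ℝ → ENNReal} (hF : Measurable F) :
    ∫⁻ y, F (∑ i, a i * y i) ∂(Measure.pi fun _ : Fin k => gaussianReal 0 1)
      = ∫⁻ t, F (√(∑ i, a i ^ 2) * t) ∂(gaussianReal 0 1) := by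
  rw [← lintegral_map hF (by fun_prop), map_sum_mul_pi_gaussianReal,
    lintegral_map hF (by fun_prop)]

theorem integral_comp_sum_mul (a : Fin k → ℝ) {F : ℝ → ℝ} (hF : Measurable F) :
    ∫ y, F (∑ i, a i * y i) ∂(Measure.pi fun _ : Fin k => gaussianReal 0 1)
      = ∫ t, F (√(∑ i, a i ^ 2) * t) ∂(gaussianReal 0 1) := by
  rw [← integral_map (f := F) (Measurable.aemeasurable (by fun_prop)) hF.aestronglyMeasurable,
    map_sum_mul_pi_gaussianReal,
    integral_map (by fun_prop) hF.aestronglyMeasurable]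

theorem integrable_comp_sum_mul (a : Fin k → ℝ) {F : ℝ → ℝ} (hF : Measurable F)
    (h : Integrable (fun t => F (√(∑ i, a i ^ 2) * t)) (gaussianReal 0 1)) :
    Integrable (fun y => F (∑ i, a i * y i)) (Measure.pi fun _ : Fin k => gaussianReal 0 1) := by
  have h2 := (integrable_map_measure (f := fun t => √(∑ i, a i ^ 2) * t) (μ := gaussianReal 0 1)
    hF.aestronglyMeasurable (by fun_prop)).2 h
  rw [← map_sum_mul_pi_gaussianReal] at h2
  exact h2.comp_measurable (by fun_prop)

/-- Fubini's theorem for the standard Gaussian, separating the coordinate `0` from the others. -/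
theorem lintegral_stdGaussian_succ {F : Point (k + 1) → ENNReal} (hF : Measurable F) :
    ∫⁻ x, F x ∂(stdGaussian (Point (k + 1)))
      = ∫⁻ y, ∫⁻ t, F (WithLp.toLp 2 (Fin.cons t y : Fin (k + 1) → ℝ)) ∂(gaussianReal 0 1)
          ∂(Measure.pi fun _ : Fin k => gaussianReal 0 1) := by
  have hF' : Measurable fun x : Fin (k + 1) → ℝ => F (WithLp.toLp 2 x) := hF.comp (by fun_prop)
  rw [← map_pi_eq_stdGaussian, lintegral_map hF (by fun_prop),
    ← ((measurePreserving_piFinSuccAbove (fun _ : Fin (k + 1) => gaussianReal 0 1)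
      0).symm).lintegral_comp_emb
      (MeasurableEquiv.measurableEmbedding _), lintegral_prod_symm]
  · simp_rw [MeasurableEquiv.piFinSuccAbove_symm_apply, Fin.insertNthEquiv, Fin.insertNth_zero,
      Equiv.coe_fn_mk]
    rfl
  · exact (hF'.comp (MeasurableEquiv.measurable _)).aemeasurable

end pi

theorem integrable_abs_pow_gaussianReal (p : ℕ) :
    Integrable (fun t : ℝ => |t| ^ p) (gaussianReal 0 1) := by
  have := (memLp_id_gaussianReal (μ := 0) (v := 1) (p : NNReal)).integrable_norm_pow'
  simpa using this

theorem integral_sq_gaussianReal : ∫ t, t ^ 2 ∂(gaussianReal 0 1) = 1 := by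
  have h := variance_fun_id_gaussianReal (μ := 0) (v := 1)
  rw [variance_of_integral_eq_zero (by fun_prop) integral_id_gaussianReal] at h
  simpa using h

theorem integral_abs_gaussianReal_pos : 0 < ∫ t, |t| ∂(gaussianReal 0 1) := by
  have hi : Integrable (fun t : ℝ => |t|) (gaussianReal 0 1) := by
    simpa using integrable_abs_pow_gaussianReal 1
  rw [integral_pos_iff_support_of_nonneg (fun t => abs_nonneg t) hi]
  have : Function.support (fun t : ℝ => |t|) = {0}ᶜ := by ext; simp
  have := nullSingletonClass_gaussianReal (μ := 0) (v := 1) one_ne_zero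
  simp_all [prob_compl_eq_one_sub]

theorem gaussianReal_le_volume : gaussianReal 0 1 ≤ volume := by
  rw [gaussianReal_of_var_ne_zero 0 one_ne_zero]
  conv_rhs => rw [← withDensity_one (μ := (volume : Measure ℝ))]
  refine withDensity_mono (.of_forall fun x => ?_)
  rw [gaussianPDF, Pi.one_apply, ENNReal.ofReal_le_one, gaussianPDFReal]
  refine mul_le_one₀ (inv_le_one_of_one_le₀ ?_) (Real.exp_nonneg _) (Real.exp_le_one_iff.2 ?_)
  · rw [Real.one_le_sqrt]; simp; linarith [Real.pi_gt_three]
  · rw [neg_div]; exact neg_nonpos.2 (by positivity)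

/-- A lower bound for the Gaussian mass of a short interval near `0`; no order between `p` and `q`
is needed, and the bound is void when the interval reaches far from `0`. -/
theorem le_gaussianReal_Ico (p q : ℝ) :
    ENNReal.ofReal (gaussianPDFReal 0 1 1 * (q - p - p ^ 2 - q ^ 2)) ≤ gaussianReal 0 1 (Set.Ico p q) := by
  rw [gaussianReal_apply 0 one_ne_zero]
  calc ENNReal.ofReal (gaussianPDFReal 0 1 1 * (q - p - p ^ 2 - q ^ 2))
      ≤ ENNReal.ofReal (gaussianPDFReal 0 1 1 * (min q 1 - max p (-1))) := by
        refine ENNReal.ofReal_le_ofReal (mul_le_mul_of_nonneg_left ?_ (gaussianPDFReal_nonneg _ _ _))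
        -- Truncate to `[-1, 1]`, where the density is at least its value at `1`.
        have h1 : q - q ^ 2 ≤ min q 1 := le_min (by nlinarith) (by nlinarith [sq_nonneg (q - 1)])
        have h2 : max p (-1) ≤ p + p ^ 2 := max_le (by nlinarith) (by nlinarith [sq_nonneg (p + 1)])
        linarith
    _ = ∫⁻ _ in Set.Ico (max p (-1)) (min q 1), gaussianPDF 0 1 1 := by
        rw [setLIntegral_const, Real.volume_Ico, ENNReal.ofReal_mul (gaussianPDFReal_nonneg _ _ _)]
        rfl
    _ ≤ ∫⁻ x in Set.Ico (max p (-1)) (min q 1), gaussianPDF 0 1 x := by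
        refine setLIntegral_mono (measurable_gaussianPDF 0 1) fun x hx => ?_
        refine ENNReal.ofReal_le_ofReal ?_
        rw [gaussianPDFReal, gaussianPDFReal]
        have h1 : -1 ≤ x := (le_max_right _ _).trans hx.1
        have h2 : x ≤ 1 := hx.2.le.trans (min_le_right _ _)
        have h3 : (x - 0) ^ 2 ≤ (1 - 0) ^ 2 := by nlinarith
        gcongr
    _ ≤ _ := lintegral_mono_set (Set.Ico_subset_Ico (le_max_left _ _) (min_le_left _ _))

/-! ### Halfspaces with a tilted normal -/

variable {k : ℕ}

/-- The halfspace with normal `(1, a)`: its boundary is the hyperplane `x₀ = 0` tilted by `a`. -/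
def tiltedHalfspace (a : Fin k → ℝ) : Point (k + 1) → Label :=
  halfspace (WithLp.toLp 2 (Fin.cons 1 a : Fin (k + 1) → ℝ))

theorem measurable_halfspace {d : ℕ} (w : Point d) : Measurable (halfspace w) := by
  classical
  unfold halfspace
  exact Measurable.ite (measurableSet_le measurable_const (by fun_prop)) measurable_const
    measurable_const

theorem tiltedHalfspace_mem (a : Fin k → ℝ) :
    tiltedHalfspace a ∈ homogeneousHalfspaces (k + 1) := by
  refine ⟨_, fun h => ?_, rfl⟩
  have := congrArg (fun v : Point (k + 1) => v 0) h
  simp at this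

theorem tiltedHalfspace_cons (a : Fin k → ℝ) (t : ℝ) (y : Fin k → ℝ) :
    tiltedHalfspace a (WithLp.toLp 2 (Fin.cons t y : Fin (k + 1) → ℝ))
      = open scoped Classical in if 0 ≤ t + ∑ i, a i * y i then 1 else -1 := by
  simp [tiltedHalfspace, halfspace, PiLp.inner_apply, Fin.sum_univ_succ, mul_comm]

theorem tiltedHalfspace_cons_ne_iff (a b : Fin k → ℝ) (t : ℝ) (y : Fin k → ℝ) :
    tiltedHalfspace a (WithLp.toLp 2 (Fin.cons t y : Fin (k + 1) → ℝ))
        ≠ tiltedHalfspace b (WithLp.toLp 2 (Fin.cons t y : Fin (k + 1) → ℝ))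
      ↔ ¬ (0 ≤ t + ∑ i, a i * y i ↔ 0 ≤ t + ∑ i, b i * y i) := by
  rw [tiltedHalfspace_cons, tiltedHalfspace_cons]
  by_cases h1 : 0 ≤ t + ∑ i, a i * y i <;> by_cases h2 : 0 ≤ t + ∑ i, b i * y i <;>
    simp [h1, h2]

theorem measurableSet_tiltedHalfspace_ne (a b : Fin k → ℝ) :
    MeasurableSet {x | tiltedHalfspace a x ≠ tiltedHalfspace b x} :=
  measurableSet_ne (measurable_halfspace _) (measurable_halfspace _)

/-- Given the coordinates other than `x₀`, two tilted halfspaces disagree when `x₀` is between two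
thresholds, which are Gaussian linear forms in the other coordinates. The expected gap between the
thresholds is proportional to the length of `a - b`; the sums of squares account for the event that
a threshold is not small. -/
theorem le_measureReal_tiltedHalfspace_ne (a b : Fin k → ℝ) :
    gaussianPDFReal 0 1 1 * ((∫ t, |t| ∂(gaussianReal 0 1)) * √(∑ i, (a i - b i) ^ 2)
        - ∑ i, a i ^ 2 - ∑ i, b i ^ 2)
      ≤ (stdGaussian (Point (k + 1))).real {x | tiltedHalfspace a x ≠ tiltedHalfspace b x} := by
  have hms := measurableSet_tiltedHalfspace_ne a b
  set c₀ := gaussianPDFReal 0 1 1 with hc₀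
  set u : (Fin k → ℝ) → ℝ := fun y => ∑ i, a i * y i with hu
  set v : (Fin k → ℝ) → ℝ := fun y => ∑ i, b i * y i with hv
  set G : (Fin k → ℝ) → ℝ := fun y => c₀ * (|∑ i, (a i - b i) * y i| - u y ^ 2 - v y ^ 2) with hG
  have hsq : ∀ s : ℝ, Integrable (fun t : ℝ => (s * t) ^ 2) (gaussianReal 0 1) := fun s => by
    have := (integrable_abs_pow_gaussianReal 2).const_mul (s ^ 2)
    simpa [mul_pow] using this
  have i1 : Integrable (fun y => |∑ i, (a i - b i) * y i|)
      (Measure.pi fun _ : Fin k => gaussianReal 0 1) := by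
    refine integrable_comp_sum_mul (fun i => a i - b i) (F := fun t => |t|) (by fun_prop) ?_
    have := (integrable_abs_pow_gaussianReal 1).const_mul |√(∑ i, (a i - b i) ^ 2)|
    simpa [abs_mul] using this
  have i2 : Integrable (fun y => u y ^ 2) (Measure.pi fun _ : Fin k => gaussianReal 0 1) :=
    integrable_comp_sum_mul a (F := fun t => t ^ 2) (by fun_prop) (hsq _)
  have i3 : Integrable (fun y => v y ^ 2) (Measure.pi fun _ : Fin k => gaussianReal 0 1) :=
    integrable_comp_sum_mul b (F := fun t => t ^ 2) (by fun_prop) (hsq _)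
  have e2 : ∀ a : Fin k → ℝ, ∫ y, (∑ i, a i * y i) ^ 2 ∂(Measure.pi fun _ : Fin k => gaussianReal 0 1)
      = ∑ i, a i ^ 2 := fun a => by
    rw [integral_comp_sum_mul a (F := fun t => t ^ 2) (by fun_prop)]
    simp_rw [mul_pow, Real.sq_sqrt (Finset.sum_nonneg fun i _ => sq_nonneg (a i))]
    rw [integral_const_mul, integral_sq_gaussianReal, mul_one]
  have e1 : ∫ y, |∑ i, (a i - b i) * y i| ∂(Measure.pi fun _ : Fin k => gaussianReal 0 1)
      = (∫ t, |t| ∂(gaussianReal 0 1)) * √(∑ i, (a i - b i) ^ 2) := by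
    rw [integral_comp_sum_mul (fun i => a i - b i) (F := fun t => |t|) (by fun_prop)]
    simp_rw [abs_mul, abs_of_nonneg (Real.sqrt_nonneg _)]
    rw [integral_const_mul, mul_comm]
  have i12 : Integrable (fun y => |∑ i, (a i - b i) * y i| - u y ^ 2)
      (Measure.pi fun _ : Fin k => gaussianReal 0 1) := i1.sub i2
  have hGi : Integrable G (Measure.pi fun _ : Fin k => gaussianReal 0 1) :=
    (i12.sub i3).const_mul _
  have hGe : ∫ y, G y ∂(Measure.pi fun _ : Fin k => gaussianReal 0 1)
      = c₀ * ((∫ t, |t| ∂(gaussianReal 0 1)) * √(∑ i, (a i - b i) ^ 2)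
        - ∑ i, a i ^ 2 - ∑ i, b i ^ 2) := by
    rw [hG, integral_const_mul, integral_sub i12 i3, integral_sub i1 i2, e1, e2, e2]
  rw [← hGe, Measure.real]
  refine (ENNReal.ofReal_le_iff_le_toReal (by finiteness)).1 ?_
  calc ENNReal.ofReal (∫ y, G y ∂(Measure.pi fun _ : Fin k => gaussianReal 0 1))
      ≤ ENNReal.ofReal (∫ y, max (G y) 0 ∂(Measure.pi fun _ : Fin k => gaussianReal 0 1)) :=
        ENNReal.ofReal_le_ofReal (integral_mono hGi hGi.pos_part fun y => le_max_left _ _)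
    _ = ∫⁻ y, ENNReal.ofReal (G y) ∂(Measure.pi fun _ : Fin k => gaussianReal 0 1) := by
        rw [ofReal_integral_eq_lintegral_ofReal hGi.pos_part (.of_forall fun y => le_max_right _ _)]
        simp [ENNReal.ofReal_max]
    _ ≤ _ := by
        rw [← lintegral_indicator_one hms,
          lintegral_stdGaussian_succ (measurable_one.indicator hms)]
        refine lintegral_mono fun y => ?_
        have hle : max (-u y) (-v y) - min (-u y) (-v y) = |∑ i, (a i - b i) * y i| := by
          rw [max_sub_min_eq_abs, abs_sub_comm]
          simp only [hu, hv, sub_mul, Finset.sum_sub_distrib]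
          rw [← abs_neg]; ring_nf
        have hsqs : min (-u y) (-v y) ^ 2 + max (-u y) (-v y) ^ 2 = u y ^ 2 + v y ^ 2 := by
          rcases le_total (-u y) (-v y) with h | h <;> simp [h, add_comm]
        calc ENNReal.ofReal (G y)
            ≤ gaussianReal 0 1 (Set.Ico (min (-u y) (-v y)) (max (-u y) (-v y))) := by
              refine le_trans (ENNReal.ofReal_le_ofReal ?_) (le_gaussianReal_Ico _ _)
              rw [hle]
              refine mul_le_mul_of_nonneg_left ?_ (gaussianPDFReal_nonneg _ _ _)
              linarith
          _ = ∫⁻ t, (Set.Ico (min (-u y) (-v y)) (max (-u y) (-v y))).indicator 1 t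
                ∂(gaussianReal 0 1) := (lintegral_indicator_one measurableSet_Ico).symm
          _ ≤ _ := by
              refine lintegral_mono fun t => ?_
              by_cases ht : t ∈ Set.Ico (min (-u y) (-v y)) (max (-u y) (-v y))
              · suffices hmem : (WithLp.toLp 2 (Fin.cons t y : Fin (k + 1) → ℝ))
                    ∈ {x | tiltedHalfspace a x ≠ tiltedHalfspace b x} by
                  rw [Set.indicator_of_mem ht, Set.indicator_of_mem hmem]
                  exact le_rfl
                rw [Set.mem_ofPred_eq, tiltedHalfspace_cons_ne_iff]
                change ¬ (0 ≤ t + u y ↔ 0 ≤ t + v y)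
                rcases le_total (-u y) (-v y) with h | h
                · rw [min_eq_left h, max_eq_right h] at ht
                  exact fun hi => absurd (hi.1 (by linarith [ht.1])) (by linarith [ht.2])
                · rw [min_eq_right h, max_eq_left h] at ht
                  exact fun hi => absurd (hi.2 (by linarith [ht.1])) (by linarith [ht.2])
              · rw [Set.indicator_of_notMem ht]
                exact zero_le

/-- The weight `1 / (1 + (x₀ / ρ)²)` at distance `|x₀|` from the central hyperplane. It is integrable
at the scale `ρ`, while its inverse grows slowly enough to be integrated over the region where a
tilted halfspace disagrees with the central one. -/
def slabWeight (ρ : ℝ) (x : Point (k + 1)) : ℝ := (1 + (x 0 / ρ) ^ 2)⁻¹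

theorem measurable_slabWeight (ρ : ℝ) : Measurable (slabWeight ρ : Point (k + 1) → ℝ) := by
  unfold slabWeight; fun_prop

theorem slabWeight_pos (ρ : ℝ) (x : Point (k + 1)) : 0 < slabWeight ρ x := by
  unfold slabWeight; positivity

/-- The constant `C` in the second moment bound `1 + h² ρ C` for one observation. -/
def gaussianSlabConst : ℝ := Real.pi + ∫ t, 2 * |t| * (1 + t ^ 2) ∂(gaussianReal 0 1)

theorem lintegral_slabWeight_le {ρ : ℝ} (hρ : 0 < ρ) :
    ∫⁻ x, ENNReal.ofReal (slabWeight ρ x) ∂(stdGaussian (Point (k + 1)))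
      ≤ ENNReal.ofReal (ρ * Real.pi) := by
  rw [lintegral_stdGaussian_succ (measurable_slabWeight ρ).ennreal_ofReal]
  calc _ = ∫⁻ _, ∫⁻ t, ENNReal.ofReal ((1 + (t / ρ) ^ 2)⁻¹) ∂(gaussianReal 0 1)
          ∂(Measure.pi fun _ : Fin k => gaussianReal 0 1) := rfl
    _ = ∫⁻ t, ENNReal.ofReal ((1 + (t / ρ) ^ 2)⁻¹) ∂(gaussianReal 0 1) := by simp
    _ ≤ ∫⁻ t, ENNReal.ofReal ((1 + (t / ρ) ^ 2)⁻¹) := lintegral_mono' gaussianReal_le_volume le_rfl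
    _ = ENNReal.ofReal (∫ t : ℝ, (1 + (t / ρ) ^ 2)⁻¹) :=
        (ofReal_integral_eq_lintegral_ofReal (integrable_inv_one_add_sq.comp_div hρ.ne')
          (.of_forall fun t => by positivity)).symm
    _ = ENNReal.ofReal (ρ * Real.pi) := by
        rw [Measure.integral_comp_div (fun t : ℝ => (1 + t ^ 2)⁻¹), integral_univ_inv_one_add_sq,
          abs_of_pos hρ, smul_eq_mul]

theorem measurable_indicator_inv_slabWeight (ρ : ℝ) (a : Fin k → ℝ) :
    Measurable fun x => {x | tiltedHalfspace a x ≠ tiltedHalfspace 0 x}.indicator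
        (fun x => ENNReal.ofReal (slabWeight ρ x)⁻¹) x :=
  (measurable_slabWeight ρ).inv.ennreal_ofReal.indicator (measurableSet_tiltedHalfspace_ne a 0)

/-- The two halfspaces disagree only for `|x₀| ≤ |⟨a, y⟩|`, with `y` the other coordinates. Given `y`
the integral is therefore at most a cubic in `|⟨a, y⟩| / ρ`, times `ρ`, and `⟨a, y⟩` is a centered
Gaussian of standard deviation at most `ρ`. -/
theorem lintegral_inv_slabWeight_le {ρ : ℝ} (hρ : 0 < ρ) (a : Fin k → ℝ)
    (ha : ∑ i, a i ^ 2 ≤ ρ ^ 2) :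
    ∫⁻ x, {x | tiltedHalfspace a x ≠ tiltedHalfspace 0 x}.indicator
        (fun x => ENNReal.ofReal (slabWeight ρ x)⁻¹) x ∂(stdGaussian (Point (k + 1)))
      ≤ ENNReal.ofReal (ρ * ∫ t, 2 * |t| * (1 + t ^ 2) ∂(gaussianReal 0 1)) := by
  have hs : √(∑ i, a i ^ 2) ≤ ρ := Real.sqrt_le_iff.2 ⟨hρ.le, ha⟩
  have hi : Integrable (fun t : ℝ => 2 * |t| * (1 + t ^ 2)) (gaussianReal 0 1) := by
    have h := ((integrable_abs_pow_gaussianReal 1).add (integrable_abs_pow_gaussianReal 3)).const_mul 2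
    refine h.congr (.of_forall fun t => ?_)
    simp only [Pi.add_apply]
    rw [← sq_abs t]; ring
  rw [lintegral_stdGaussian_succ (measurable_indicator_inv_slabWeight ρ a)]
  calc _ ≤ ∫⁻ y, (fun v : ℝ => ENNReal.ofReal (2 * |v| * (1 + (v / ρ) ^ 2))) (∑ i, a i * y i)
          ∂(Measure.pi fun _ : Fin k => gaussianReal 0 1) := by
        refine lintegral_mono fun y => ?_
        set v := ∑ i, a i * y i with hv
        calc _ ≤ ∫⁻ t, (Set.Icc (-|v|) |v|).indicator
                (fun _ => ENNReal.ofReal (1 + (v / ρ) ^ 2)) t ∂(gaussianReal 0 1) := by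
              refine lintegral_mono fun t => ?_
              by_cases ht : (WithLp.toLp 2 (Fin.cons t y : Fin (k + 1) → ℝ))
                  ∈ {x | tiltedHalfspace a x ≠ tiltedHalfspace 0 x}
              swap
              · rw [Set.indicator_of_notMem ht]
                exact zero_le
              rw [Set.indicator_of_mem ht]
              rw [Set.mem_ofPred_eq, tiltedHalfspace_cons_ne_iff, ← hv] at ht
              simp only [Pi.zero_apply, zero_mul, Finset.sum_const_zero, add_zero] at ht
              have htv : |t| ≤ |v| := by
                by_cases h0 : 0 ≤ t
                · have : t + v < 0 := by
                    by_contra! h; exact ht ⟨fun _ => h0, fun _ => h⟩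
                  rw [abs_of_nonneg h0, abs_of_neg (by linarith)]; linarith
                · have : 0 ≤ t + v := by
                    by_contra! h; exact ht ⟨fun h' => absurd h' h.not_ge, fun h' => absurd h' h0⟩
                  push Not at h0
                  rw [abs_of_neg h0, abs_of_nonneg (by linarith)]; linarith
              rw [Set.indicator_of_mem (show t ∈ Set.Icc (-|v|) |v| from abs_le.1 htv)]
              refine ENNReal.ofReal_le_ofReal ?_
              simp only [slabWeight, inv_inv, Fin.cons_zero, div_pow]
              have := sq_le_sq.2 htv
              gcongr
          _ = ENNReal.ofReal (1 + (v / ρ) ^ 2) * gaussianReal 0 1 (Set.Icc (-|v|) |v|) :=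
              lintegral_indicator_const measurableSet_Icc _
          _ ≤ ENNReal.ofReal (1 + (v / ρ) ^ 2) * volume (Set.Icc (-|v|) |v|) := by
              gcongr; exact gaussianReal_le_volume
          _ = _ := by
              rw [Real.volume_Icc, ← ENNReal.ofReal_mul (by positivity)]
              congr 1; ring
    _ = ∫⁻ t, ENNReal.ofReal (2 * |√(∑ i, a i ^ 2) * t| * (1 + (√(∑ i, a i ^ 2) * t / ρ) ^ 2))
          ∂(gaussianReal 0 1) := lintegral_comp_sum_mul a
          (F := fun v : ℝ => ENNReal.ofReal (2 * |v| * (1 + (v / ρ) ^ 2))) (by fun_prop)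
    _ ≤ ∫⁻ t, ENNReal.ofReal (ρ * (2 * |t| * (1 + t ^ 2))) ∂(gaussianReal 0 1) := by
        refine lintegral_mono fun t => ENNReal.ofReal_le_ofReal ?_
        have h1 : (√(∑ i, a i ^ 2) * t / ρ) ^ 2 ≤ t ^ 2 := by
          rw [mul_div_right_comm, mul_pow]
          exact mul_le_of_le_one_left (sq_nonneg t)
            (pow_le_one₀ (by positivity) ((div_le_one hρ).2 hs))
        rw [abs_mul, abs_of_nonneg (Real.sqrt_nonneg _)]
        calc 2 * (√(∑ i, a i ^ 2) * |t|) * (1 + (√(∑ i, a i ^ 2) * t / ρ) ^ 2)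
            ≤ 2 * (ρ * |t|) * (1 + t ^ 2) := by gcongr
          _ = _ := by ring
    _ = _ := by
        rw [← integral_const_mul, ofReal_integral_eq_lintegral_ofReal (hi.const_mul ρ)
          (.of_forall fun t => by positivity)]

/-- The mean of the label given `x` in the reference law: the bias `h` towards the central halfspace
is damped near its boundary. With `φ = slabWeight ρ x` and `η = φ / (1 + φ)` the damping is
`1 - 2 * η`, as if the noisy label were flipped with probability `η`. -/
def smoothedBias (h ρ : ℝ) (x : Point (k + 1)) : ℝ :=
  h * ((1 - slabWeight ρ x) / (1 + slabWeight ρ x)) * ((tiltedHalfspace (0 : Fin k → ℝ) x : ℤ) : ℝ)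

theorem measurable_smoothedBias (h ρ : ℝ) : Measurable (smoothedBias h ρ : Point (k + 1) → ℝ) :=
  ((((measurable_slabWeight ρ).const_sub 1).div ((measurable_slabWeight ρ).const_add 1)).const_mul
    h).mul (measurable_sgn (measurable_halfspace _))

theorem abs_smoothedBias_lt {h : ℝ} (h0 : 0 ≤ h) (h1 : h ≤ 1) (ρ : ℝ) (x : Point (k + 1)) :
    |smoothedBias h ρ x| < 1 := by
  have hφ := slabWeight_pos ρ x
  have hm : |(1 - slabWeight ρ x) / (1 + slabWeight ρ x)| < 1 := by
    rw [abs_div, abs_of_pos (by linarith : 0 < 1 + slabWeight ρ x), div_lt_one (by linarith), abs_lt]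
    constructor <;> linarith
  have hs : |((tiltedHalfspace (0 : Fin k → ℝ) x : ℤ) : ℝ)| = 1 := by
    rcases Int.units_eq_one_or (tiltedHalfspace (0 : Fin k → ℝ) x) with e | e <;> simp [e]
  rw [smoothedBias, abs_mul, abs_mul, hs, mul_one, abs_of_nonneg h0]
  nlinarith [abs_nonneg ((1 - slabWeight ρ x) / (1 + slabWeight ρ x))]

theorem lintegral_likelihoodRatio_sq_tiltedHalfspace_le {h ρ : ℝ} (h0 : 0 ≤ h) (h1 : h ≤ 1)
    (hρ : 0 < ρ) (a : Fin k → ℝ) (ha : ∑ i, a i ^ 2 ≤ ρ ^ 2) :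
    ∫⁻ z, likelihoodRatio (fun x => h * ((tiltedHalfspace a x : ℤ) : ℝ)) (smoothedBias h ρ) z ^ 2
        ∂(labelLaw (stdGaussian (Point (k + 1))) (smoothedBias h ρ))
      ≤ ENNReal.ofReal (1 + h ^ 2 * (ρ * gaussianSlabConst)) := by
  have hfa : Measurable (tiltedHalfspace a) := measurable_halfspace _
  have hK : 0 ≤ ∫ t, 2 * |t| * (1 + t ^ 2) ∂(gaussianReal 0 1) :=
    integral_nonneg fun t => by positivity
  rw [lintegral_likelihoodRatio_sq ((measurable_sgn hfa).const_mul h) (measurable_smoothedBias h ρ)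
    (abs_mul_sgn_le h0 h1) (abs_smoothedBias_lt h0 h1 ρ)]
  calc _ ≤ ∫⁻ x, (1 + ENNReal.ofReal (h ^ 2) * (ENNReal.ofReal (slabWeight ρ x)
          + {x | tiltedHalfspace a x ≠ tiltedHalfspace 0 x}.indicator
        (fun x => ENNReal.ofReal (slabWeight ρ x)⁻¹) x)) ∂(stdGaussian (Point (k + 1))) := by
        refine lintegral_mono fun x => ?_
        have hφ := slabWeight_pos ρ x
        have hlab : ∀ y : Label, ((y : ℤ) : ℝ) = 1 ∨ ((y : ℤ) : ℝ) = -1 := fun y => by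
          rcases Int.units_eq_one_or y with e | e <;> simp [e]
        refine (ENNReal.ofReal_le_ofReal (add_le_add_right (chiSq_le h0 h1 hφ
          (hlab (tiltedHalfspace a x)) (hlab (tiltedHalfspace 0 x))) 1)).trans ?_
        by_cases hx : tiltedHalfspace a x = tiltedHalfspace 0 x
        · rw [hx, if_pos rfl, Set.indicator_of_notMem (by simpa using hx), add_zero, add_zero,
            ENNReal.ofReal_add zero_le_one (by positivity), ENNReal.ofReal_mul (by positivity),
            ENNReal.ofReal_one]
        · rw [if_neg (by exact_mod_cast fun e => hx (Units.ext e)), Set.indicator_of_mem hx,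
            ENNReal.ofReal_add zero_le_one (by positivity), ENNReal.ofReal_mul (by positivity),
            ENNReal.ofReal_one, ENNReal.ofReal_add hφ.le (by positivity)]
    _ ≤ 1 + ENNReal.ofReal (h ^ 2) * (ENNReal.ofReal (ρ * Real.pi)
          + ENNReal.ofReal (ρ * ∫ t, 2 * |t| * (1 + t ^ 2) ∂(gaussianReal 0 1))) := by
        rw [lintegral_add_left measurable_const, lintegral_const_mul' _ _ ENNReal.ofReal_ne_top,
          lintegral_add_left (measurable_slabWeight ρ).ennreal_ofReal, lintegral_one, measure_univ]
        gcongr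
        · exact lintegral_slabWeight_le hρ
        · exact lintegral_inv_slabWeight_le hρ a ha
    _ = _ := by
        have := Real.pi_pos
        rw [← ENNReal.ofReal_add (by positivity) (by positivity), ← ENNReal.ofReal_mul (by positivity),
          ← ENNReal.ofReal_one, ← ENNReal.ofReal_add zero_le_one (by positivity), gaussianSlabConst]
        ring_nf

/-! ### The cube of candidates and the lower bound -/

/-- An exponential Markov bound: each `σ` in the ball has weight
`(5 / 4) ^ (k - 8 * hammingDist σ τ) ≥ 1`, and the sum of the weights over the cube factorizes. -/
theorem card_hammingBall_le {k : ℕ} (τ : Fin k → Bool) :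
    (({σ | 8 * hammingDist σ τ ≤ k} : Finset (Fin k → Bool)).card : ℝ) ≤ (3 / 2) ^ k := by
  set g : Fin k → Bool → ℝ := fun i b => 5 / 4 * if b ≠ τ i then (4 / 5) ^ 8 else 1 with hg
  have hprod : ∀ σ : Fin k → Bool, ∏ i, g i (σ i) = (5 / 4) ^ k * ((4 / 5) ^ 8) ^ hammingDist σ τ := by
    intro σ
    simp only [hg]
    rw [Finset.prod_mul_distrib, Finset.prod_const, Finset.card_univ, Fintype.card_fin,
      Finset.prod_ite, Finset.prod_const_one, mul_one, Finset.prod_const]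
    rfl
  calc (({σ | 8 * hammingDist σ τ ≤ k} : Finset (Fin k → Bool)).card : ℝ)
      = ∑ σ ∈ ({σ | 8 * hammingDist σ τ ≤ k} : Finset (Fin k → Bool)), 1 := by simp
    _ ≤ ∑ σ ∈ ({σ | 8 * hammingDist σ τ ≤ k} : Finset (Fin k → Bool)), ∏ i, g i (σ i) := by
        refine Finset.sum_le_sum fun σ hσ => ?_
        rw [Finset.mem_filter] at hσ
        rw [hprod, ← pow_mul]
        calc (1 : ℝ) = (5 / 4) ^ k * (4 / 5) ^ k := by rw [← mul_pow]; norm_num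
          _ ≤ _ := mul_le_mul_of_nonneg_left
              (pow_le_pow_of_le_one (by norm_num) (by norm_num) hσ.2) (by positivity)
    _ ≤ ∑ σ : Fin k → Bool, ∏ i, g i (σ i) := by
        refine Finset.sum_le_sum_of_subset_of_nonneg (Finset.subset_univ _) fun σ _ _ => ?_
        rw [hprod]; positivity
    _ = ∏ i, ∑ b, g i b := by rw [Finset.prod_univ_sum, Fintype.piFinset_univ]
    _ ≤ ∏ _i : Fin k, (3 / 2 : ℝ) := by
        refine Finset.prod_le_prod (fun i _ => Finset.sum_nonneg fun b _ => ?_) fun i _ => ?_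
        · simp only [hg]; split_ifs <;> positivity
        · simp only [hg, Fintype.sum_bool]
          cases τ i <;> simp <;> norm_num
    _ = (3 / 2) ^ k := by rw [Finset.prod_const, Finset.card_univ, Fintype.card_fin]

/-- The tilt of the candidate with cube vertex `σ`. -/
def cubeTilt {k : ℕ} (δ : ℝ) (σ : Fin k → Bool) (i : Fin k) : ℝ := if σ i then δ else 0

theorem sum_cubeTilt_sq_le {k : ℕ} (δ : ℝ) (σ : Fin k → Bool) :
    ∑ i, cubeTilt δ σ i ^ 2 ≤ k * δ ^ 2 := by
  calc ∑ i, cubeTilt δ σ i ^ 2 ≤ ∑ _i : Fin k, δ ^ 2 := by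
        refine Finset.sum_le_sum fun i _ => ?_
        unfold cubeTilt; split_ifs <;> simp [sq_nonneg]
    _ = k * δ ^ 2 := by simp

theorem sum_cubeTilt_sub_sq {k : ℕ} (δ : ℝ) (σ τ : Fin k → Bool) :
    ∑ i, (cubeTilt δ σ i - cubeTilt δ τ i) ^ 2 = hammingDist σ τ * δ ^ 2 := by
  have : ∀ i, (cubeTilt δ σ i - cubeTilt δ τ i) ^ 2 = if σ i ≠ τ i then δ ^ 2 else 0 := by
    intro i
    unfold cubeTilt
    cases σ i <;> cases τ i <;> simp
  simp_rw [this]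
  rw [← Finset.sum_filter, Finset.sum_const, nsmul_eq_mul]
  rfl

/-- The mean of `|t|` for a standard Gaussian `t`. -/
def gaussianAbsMean : ℝ := ∫ t, |t| ∂(gaussianReal 0 1)

/-- Candidates that are close as classifiers have cube vertices that are close in Hamming distance. -/
theorem hammingDist_le_of_close {k : ℕ} {ρ δ : ℝ} (hρ : 0 < ρ)
    (hρδ : k * δ ^ 2 = ρ ^ 2) (hρ1 : ρ ≤ gaussianAbsMean / 12) {σ τ : Fin k → Bool}
    (h : (stdGaussian (Point (k + 1))).real
      {x | tiltedHalfspace (cubeTilt δ σ) x ≠ tiltedHalfspace (cubeTilt δ τ) x}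
        < gaussianPDFReal 0 1 1 * gaussianAbsMean * ρ / 6) :
    8 * hammingDist σ τ ≤ k := by
  by_contra! hk
  refine h.not_ge (le_trans ?_ (le_measureReal_tiltedHalfspace_ne _ _))
  have hc := gaussianPDFReal_nonneg 0 1 1
  have hm : 0 < gaussianAbsMean := integral_abs_gaussianReal_pos
  have hs : ρ / 3 ≤ √(∑ i, (cubeTilt δ σ i - cubeTilt δ τ i) ^ 2) := by
    refine Real.le_sqrt_of_sq_le ?_
    rw [sum_cubeTilt_sub_sq, div_pow, ← hρδ]
    have : (k : ℝ) ≤ 8 * hammingDist σ τ := by exact_mod_cast hk.le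
    nlinarith [sq_nonneg δ]
  have h1 := (sum_cubeTilt_sq_le δ σ).trans_eq hρδ
  have h2 := (sum_cubeTilt_sq_le δ τ).trans_eq hρδ
  have h3 := mul_le_mul_of_nonneg_left hs hm.le
  rw [mul_assoc, mul_div_assoc]
  refine mul_le_mul_of_nonneg_left ?_ hc
  change _ ≤ gaussianAbsMean * _ - _ - _
  nlinarith

/-- The lower bound at the scale `ρ`, for `ρ` so small that the `n` observations cannot tell the
candidates apart. -/
theorem exists_le_expectedExcessRisk {k n : ℕ} (hk : 1 ≤ k) {h ρ : ℝ} (h0 : 0 < h) (h1 : h ≤ 1)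
    (hρ : 0 < ρ) (hρ1 : ρ ≤ gaussianAbsMean / 12)
    (hρn : n * (h ^ 2 * (ρ * gaussianSlabConst)) ≤ k * Real.log (8 / 7))
    {Ω : Type*} [MeasurableSpace Ω] (Q : Measure Ω) [IsProbabilityMeasure Q]
    (A : LearningAlgorithm Ω (k + 1) n) :
    ∃ a : Fin k → ℝ, h * (gaussianPDFReal 0 1 1 * gaussianAbsMean * ρ / 12 * (1 - 13 / 14))
      ≤ expectedExcessRisk Q A (noisyLaw (stdGaussian (Point (k + 1))) h (tiltedHalfspace a))
          (tiltedHalfspace a) := by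
  classical
  set μ := stdGaussian (Point (k + 1)) with hμ
  set r := gaussianPDFReal 0 1 1 * gaussianAbsMean * ρ / 12 with hr
  have hm : 0 < gaussianAbsMean := integral_abs_gaussianReal_pos
  have hr0 : 0 ≤ r := by
    have := gaussianPDFReal_nonneg 0 1 1
    positivity
  have hk0 : (0 : ℝ) < k := by exact_mod_cast hk
  -- Edge length of the cube, so that every tilt has length at most `ρ`.
  set δ := ρ / √k with hδ
  have hρδ : k * δ ^ 2 = ρ ^ 2 := by
    rw [hδ, div_pow, Real.sq_sqrt hk0.le]; field_simp
  set f : (Fin k → Bool) → Point (k + 1) → Label := fun σ => tiltedHalfspace (cubeTilt δ σ) with hf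
  have hfm : ∀ σ, Measurable (f σ) := fun σ => measurable_halfspace _
  have hbm := measurable_smoothedBias (k := k) h ρ
  have hb1 := abs_smoothedBias_lt (k := k) h0.le h1 ρ
  have hPm := fun σ => (measurable_sgn (hfm σ)).const_mul h
  have hwd : ∀ σ, noisyLaw μ h (f σ) = (labelLaw μ (smoothedBias h ρ)).withDensity
      (likelihoodRatio (fun x => h * ((f σ x : ℤ) : ℝ)) (smoothedBias h ρ)) := fun σ =>
    labelLaw_eq_withDensity (hPm σ) hbm hb1
  have hν : IsProbabilityMeasure (labelLaw μ (smoothedBias h ρ)) :=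
    isProbabilityMeasure_labelLaw hbm fun x => (hb1 x).le
  set S : (Fin k → Bool) → Set ((Fin n → Obs (k + 1)) × Ω) := fun σ =>
    {q | μ.real {x | A.output q.1 q.2 x ≠ f σ x} < r} with hS
  have hK : ∀ σ, (∫⁻ z, likelihoodRatio (fun x => h * ((f σ x : ℤ) : ℝ)) (smoothedBias h ρ) z ^ 2
      ∂(labelLaw μ (smoothedBias h ρ))) ^ n ≤ ((8 / 7 : NNReal) ^ k : NNReal) := by
    intro σ
    calc _ ≤ ENNReal.ofReal (1 + h ^ 2 * (ρ * gaussianSlabConst)) ^ n := by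
          gcongr
          exact lintegral_likelihoodRatio_sq_tiltedHalfspace_le h0.le h1 hρ _
            ((sum_cubeTilt_sq_le δ σ).trans_eq hρδ)
      _ ≤ ENNReal.ofReal (Real.exp (h ^ 2 * (ρ * gaussianSlabConst))) ^ n := by
          gcongr
          linarith [Real.add_one_le_exp (h ^ 2 * (ρ * gaussianSlabConst))]
      _ = ENNReal.ofReal (Real.exp (n * (h ^ 2 * (ρ * gaussianSlabConst)))) := by
          rw [← ENNReal.ofReal_pow (Real.exp_nonneg _), ← Real.exp_nat_mul]
      _ ≤ ENNReal.ofReal (Real.exp (k * Real.log (8 / 7))) := by gcongr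
      _ = ENNReal.ofReal ((8 / 7) ^ k) := by
          rw [Real.exp_nat_mul, Real.exp_log (by norm_num)]
      _ = _ := by
          rw [ENNReal.ofReal_eq_coe_nnreal (by positivity)]
          congr 1
  have hN : ∀ z, ∑ σ, (S σ).indicator (1 : (Fin n → Obs (k + 1)) × Ω → ENNReal) z
      ≤ ((3 / 2 : NNReal) ^ k : NNReal) := by
    intro z
    have hcard : ∑ σ, (S σ).indicator (1 : (Fin n → Obs (k + 1)) × Ω → ENNReal) z
        = ((Finset.univ.filter fun σ => z ∈ S σ).card : ENNReal) := by
      simp [Set.indicator_apply, Finset.sum_boole]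
    rw [hcard]
    rcases (Finset.univ.filter fun σ => z ∈ S σ).eq_empty_or_nonempty with he | ⟨τ, hτ⟩
    · simp [he]
    have hτ' : z ∈ S τ := (Finset.mem_filter.1 hτ).2
    -- Two candidates that are `r`-close to the same output are `2 * r`-close to each other.
    have hsub : (Finset.univ.filter fun σ => z ∈ S σ)
        ⊆ ({σ | 8 * hammingDist σ τ ≤ k} : Finset (Fin k → Bool)) := by
      intro σ hσ
      have hσ' : z ∈ S σ := (Finset.mem_filter.1 hσ).2
      refine Finset.mem_filter.2 ⟨Finset.mem_univ _, hammingDist_le_of_close (δ := δ)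
        hρ hρδ hρ1 ?_⟩
      have hss : {x | f σ x ≠ f τ x} ⊆ {x | A.output z.1 z.2 x ≠ f σ x}
          ∪ {x | A.output z.1 z.2 x ≠ f τ x} := by
        intro x hx
        by_contra hcon
        simp only [Set.mem_union, Set.mem_ofPred_eq, not_or, not_not] at hcon hx
        exact hx (hcon.1.symm.trans hcon.2)
      calc μ.real {x | f σ x ≠ f τ x} ≤ μ.real {x | A.output z.1 z.2 x ≠ f σ x}
            + μ.real {x | A.output z.1 z.2 x ≠ f τ x} :=
              (measureReal_mono hss).trans (measureReal_union_le _ _)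
        _ < r + r := add_lt_add hσ' hτ'
        _ = _ := by rw [hr]; ring
    have hle := (Nat.cast_le (α := ℝ)).2 (Finset.card_le_card hsub)
    have hle' := hle.trans (card_hammingBall_le τ)
    have : ((Finset.univ.filter fun σ => z ∈ S σ).card : NNReal) ≤ (3 / 2) ^ k := by
      rw [← NNReal.coe_le_coe]; push_cast; exact hle'
    exact_mod_cast this
  have hM : 7 * ((3 / 2 : NNReal) ^ k * (8 / 7) ^ k) ≤ 6 * Fintype.card (Fin k → Bool) := by
    rw [← NNReal.coe_le_coe]
    push_cast
    rw [Fintype.card_fun, Fintype.card_bool, Fintype.card_fin, ← mul_pow]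
    obtain ⟨j, rfl⟩ : ∃ j, k = j + 1 := ⟨k - 1, by omega⟩
    have : ((3 / 2 : ℝ) * (8 / 7)) ^ j ≤ 2 ^ j := pow_le_pow_left₀ (by norm_num) (by norm_num) j
    push_cast
    rw [pow_succ, pow_succ]
    linarith
  obtain ⟨σ, hσ⟩ := exists_prod_apply_le (n := n) (labelLaw μ (smoothedBias h ρ)) Q
    (fun σ => likelihoodRatio (fun x => h * ((f σ x : ℤ) : ℝ)) (smoothedBias h ρ))
    (fun σ => measurable_likelihoodRatio (hPm σ) hbm)
    (fun σ => by
      rw [← hwd]; exact isProbabilityMeasure_labelLaw (hPm σ) (abs_mul_sgn_le h0.le h1))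
    S (fun σ => measurableSet_lt (measurable_measureReal_output_ne A (hfm σ)) measurable_const)
    ((8 / 7) ^ k) ((3 / 2) ^ k) (by positivity) hK hN hM
  refine ⟨cubeTilt δ σ, le_expectedExcessRisk Q A (hfm σ) h0.le h1 hr0 ?_⟩
  rw [← hwd] at hσ
  exact hσ

theorem gaussianSlabConst_pos : 0 < gaussianSlabConst :=
  add_pos_of_pos_of_nonneg Real.pi_pos (integral_nonneg fun t => by positivity)

end Halfspaces
end

open Halfspaces ProbabilityTheory in
theorem mainTheorem7 :
    ∃ c : ℝ, 0 < c ∧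
      ∀ (d n : ℕ) (B : ℝ), 2 ≤ d → 1 ≤ B → B ≤ Real.sqrt ((n : ℝ) / (d : ℝ)) →
      ∀ (Ω : Type*) [MeasurableSpace Ω] (Q : Measure Ω) [IsProbabilityMeasure Q]
        (A : Halfspaces.LearningAlgorithm Ω d n),
      ∃ (P : Measure (Halfspaces.Obs d)) (fstar : Halfspaces.Point d → Halfspaces.Label),
        IsProbabilityMeasure P ∧
        Halfspaces.IsLogConcave P.fst ∧
        Halfspaces.IsZeroMeanIsotropic P.fst ∧
        Halfspaces.IsRiskMinimizer P (Halfspaces.homogeneousHalfspaces d) fstar ∧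
        Halfspaces.IsBernstein P
          (Halfspaces.excessLossClass (Halfspaces.homogeneousHalfspaces d) fstar) 1 B ∧
        c * (B * (d : ℝ) / (n : ℝ)) ≤ Halfspaces.expectedExcessRisk Q A P fstar := by
  have hm : 0 < gaussianAbsMean := integral_abs_gaussianReal_pos
  have hC := gaussianSlabConst_pos
  have hlog : 0 < Real.log (8 / 7) := Real.log_pos (by norm_num)
  have hc₀ := gaussianPDFReal_pos 0 1 1 one_ne_zero
  set κ := min (gaussianAbsMean / 12) (Real.log (8 / 7) / gaussianSlabConst) with hκ
  have hκ0 : 0 < κ := lt_min (by positivity) (by positivity)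
  refine ⟨gaussianPDFReal 0 1 1 * gaussianAbsMean * κ / 336, by positivity, ?_⟩
  intro d n B hd hB hBn Ω _ Q _ A
  obtain ⟨k, rfl⟩ : ∃ k, d = k + 1 := ⟨d - 1, by omega⟩
  have hk : 1 ≤ k := by omega
  have hk1 : (1 : ℝ) ≤ k := by exact_mod_cast hk
  have hB0 : 0 < B := by linarith
  have hB2 : B ^ 2 * (k + 1) ≤ n := by
    have h := (Real.le_sqrt' hB0).1 hBn
    rwa [le_div_iff₀ (by positivity), Nat.cast_add, Nat.cast_one] at h
  have hn : (0 : ℝ) < n := lt_of_lt_of_le (by positivity) hB2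
  have h0 : 0 < 1 / B := by positivity
  have h1 : 1 / B ≤ 1 := (div_le_one hB0).2 hB
  -- With this `ρ` the second moment of the likelihood ratio of the sample is at most `(8 / 7) ^ k`.
  set ρ := κ * (k * B ^ 2 / n) with hρ
  have hρκ : ρ ≤ κ := mul_le_of_le_one_right hκ0.le ((div_le_one hn).2 (by nlinarith))
  obtain ⟨a, ha⟩ := exists_le_expectedExcessRisk hk h0 h1 (ρ := ρ) (by positivity)
    (hρκ.trans (min_le_left _ _)) (by
      have h : κ * gaussianSlabConst ≤ Real.log (8 / 7) := (le_div_iff₀ hC).1 (min_le_right _ _)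
      calc n * ((1 / B) ^ 2 * (ρ * gaussianSlabConst)) = k * (κ * gaussianSlabConst) := by
            rw [hρ]; field_simp
        _ ≤ _ := by gcongr) Q A
  have hfm : Measurable (tiltedHalfspace a) := measurable_halfspace _
  have hFm : ∀ g ∈ homogeneousHalfspaces (k + 1), Measurable g := by
    rintro _ ⟨w, -, rfl⟩
    exact measurable_halfspace w
  have hbm := (measurable_sgn hfm).const_mul (1 / B)
  have hfst : (noisyLaw (stdGaussian (Point (k + 1))) (1 / B) (tiltedHalfspace a)).fst
      = stdGaussian (Point (k + 1)) := map_fst_labelLaw hbm (abs_mul_sgn_le h0.le h1)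
  refine ⟨noisyLaw (stdGaussian (Point (k + 1))) (1 / B) (tiltedHalfspace a), tiltedHalfspace a,
    isProbabilityMeasure_labelLaw hbm (abs_mul_sgn_le h0.le h1), ?_, ?_,
    isRiskMinimizer_noisyLaw h0.le h1 hFm (tiltedHalfspace_mem a), ?_, le_trans ?_ ha⟩
  · rw [hfst]; exact isLogConcave_stdGaussian _
  · rw [hfst]; exact isZeroMeanIsotropic_stdGaussian _
  · have h := isBernstein_noisyLaw (μ := stdGaussian (Point (k + 1))) h0 h1 hfm hFm
    rwa [one_div_one_div] at h
  · have e : 1 / B * (gaussianPDFReal 0 1 1 * gaussianAbsMean * ρ / 12 * (1 - 13 / 14))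
        = gaussianPDFReal 0 1 1 * gaussianAbsMean * κ / 336 * (B * (2 * k) / n) := by
      rw [hρ]; field_simp; norm_num
    rw [e]
    push_cast
    gcongr
    linarith
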